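/- Let $A$ be an associative ring, not necessarily with identity, let $\tilde A=\mathbb{Z}\ltimes A$ be the unital ring obtained from $A$ by adjoining an identity, and regard left $A$-modules as left $\tilde A$-modules and $\mathbb{Z}=\tilde A/A$ as a right $\tilde A$-module. A left $A$-module $M$ is called h-unitary if $\mathrm{Tor}_n^{\tilde A}(\mathbb{Z},M)=0$ for all $n\ge 0$. Let $\mathfrak{M}(A)$ be the full subcategory of the category of all left $A$-modules whose objects are the h-unitary modules. Then $\mathfrak{M}(A)$ is an accessible additive category; that is, it is additive, and for some infinite regular cardinal $\kappa$ it has $\kappa$-directed colimits and a set of $\kappa$-presentable objects such that every object is a $\kappa$-directed colimit of objects from this set. Moreover, let $\aleph$ be any cardinal with $\aleph\ge\max\{|A|,\aleph_0\}$, and let $\aleph^+$ be its successor. Call a submodule $L\subseteq M$ pure if every homomorphism from a finitely presented $\tilde A$-module to $M/L$ lifts to $M$. Then for every h-unitary module $M$: 1. $M$ is the $\aleph^+$-directed union of its pure h-unitary submodules of cardinality at most $\aleph$: every family of fewer than $\aleph^+$ such submodules is contained in a common such submodule, and every element of $M$ lies in such a submodule. 2. Every h-unitary submodule $L$ of $M$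 of cardinality at most $\aleph$ (in particular each of the submodules in 1) is $\aleph^+$-presentable in $\mathfrak{M}(A)$, i.e. $\mathrm{Hom}_{\mathfrak{M}(A)}(L,-)$ commutes with $\aleph^+$-directed colimits. -/

import Mathlib

universe u v

open CategoryTheory CategoryTheory.Limits Cardinal
open scoped TensorProduct

noncomputable section

namespace HUnitary

section Tensor

variable (R : Type u) [Ring R]

/-- The relations `(x r) ⊗ m = x ⊗ (r m)` that cut the tensor product over a (noncommutative)
ring `R` of a right module `X` and a left module `M` out of their tensor product over `ℤ`.
Right `R`-modules are modules over `Rᵐᵒᵖ`. -/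
def balancedRelations (X : Type v) [AddCommGroup X] [Module Rᵐᵒᵖ X]
    (M : Type u) [AddCommGroup M] [Module R M] : Submodule ℤ (X ⊗[ℤ] M) :=
  Submodule.span ℤ
    {t | ∃ (x : X) (r : R) (m : M), t = (MulOpposite.op r • x) ⊗ₜ[ℤ] m - x ⊗ₜ[ℤ] (r • m)}

/-- The tensor product `X ⊗_R M` of a right and a left `R`-module, an abelian group. -/
abbrev BalancedTensor (X : Type v) [AddCommGroup X] [Module Rᵐᵒᵖ X]
    (M : Type u) [AddCommGroup M] [Module R M] : Type (max v u) :=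
  (X ⊗[ℤ] M) ⧸ balancedRelations R X M

variable {R}

theorem balancedRelations_le_comap (X : Type v) [AddCommGroup X] [Module Rᵐᵒᵖ X]
    {M N : Type u} [AddCommGroup M] [Module R M] [AddCommGroup N] [Module R N] (f : M →ₗ[R] N) :
    balancedRelations R X M ≤
      (balancedRelations R X N).comap (f.toAddMonoidHom.toIntLinearMap.lTensor X) := by
  refine Submodule.span_le.2 ?_
  rintro _ ⟨x, r, m, rfl⟩
  refine Submodule.subset_span ⟨x, r, f m, ?_⟩
  simp

/-- The map `X ⊗_R M → X ⊗_R N` induced by an `R`-linear map `M → N`. -/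
def balancedTensorMap (X : Type v) [AddCommGroup X] [Module Rᵐᵒᵖ X]
    {M N : Type u} [AddCommGroup M] [Module R M] [AddCommGroup N] [Module R N] (f : M →ₗ[R] N) :
    BalancedTensor R X M →ₗ[ℤ] BalancedTensor R X N :=
  Submodule.mapQ _ _ (f.toAddMonoidHom.toIntLinearMap.lTensor X) (balancedRelations_le_comap X f)

theorem balancedTensorMap_mk_tmul (X : Type v) [AddCommGroup X] [Module Rᵐᵒᵖ X]
    {M N : Type u} [AddCommGroup M] [Module R M] [AddCommGroup N] [Module R N] (f : M →ₗ[R] N)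
    (x : X) (m : M) :
    balancedTensorMap X f (Submodule.Quotient.mk (x ⊗ₜ[ℤ] m)) =
      Submodule.Quotient.mk (x ⊗ₜ[ℤ] f m) := rfl

theorem balancedTensor_hom_ext (X : Type v) [AddCommGroup X] [Module Rᵐᵒᵖ X]
    {M : Type u} [AddCommGroup M] [Module R M] {P : Type*} [AddCommGroup P]
    {f g : BalancedTensor R X M →ₗ[ℤ] P}
    (h : ∀ (x : X) (m : M), f (Submodule.Quotient.mk (x ⊗ₜ[ℤ] m)) =
      g (Submodule.Quotient.mk (x ⊗ₜ[ℤ] m))) : f = g := by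
  refine Submodule.linearMap_qext _ (TensorProduct.ext' fun x m => ?_)
  exact h x m

/-- The functor `X ⊗_R -` from left `R`-modules to abelian groups. -/
def tensorFunctor (X : ModuleCat.{v} Rᵐᵒᵖ) : ModuleCat.{u} R ⥤ ModuleCat.{max v u} ℤ where
  obj M := ModuleCat.of ℤ (BalancedTensor R X M)
  map f := ModuleCat.ofHom (balancedTensorMap X f.hom)
  map_id M := by
    ext1
    exact balancedTensor_hom_ext X fun x m => rfl
  map_comp f g := by
    ext1
    exact balancedTensor_hom_ext X fun x m => rfl

instance tensorFunctor_additive (X : ModuleCat.{v} Rᵐᵒᵖ) :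
    (tensorFunctor X : ModuleCat.{u} R ⥤ _).Additive where
  map_add {M N f g} := by
    ext1
    refine balancedTensor_hom_ext X fun x m => ?_
    exact congrArg (balancedRelations R X N).mkQ (TensorProduct.tmul_add x (f.hom m) (g.hom m))

/-- `Tor_n^R(X, M)`, the value at `M` of the `n`-th left derived functor of `X ⊗_R -`. -/
def tor (n : ℕ) (X : ModuleCat.{v} Rᵐᵒᵖ) (M : ModuleCat.{u} R) : ModuleCat.{max v u} ℤ :=
  ((tensorFunctor X).leftDerived n).obj M

end Tensor

section Modules

variable {R : Type u} [Ring R] {M : Type u} [AddCommGroup M] [Module R M]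

/-- `L` is a pure submodule of `M`: every homomorphism from a finitely presented module to
`M ⧸ L` lifts to `M`. -/
def IsPure (L : Submodule R M) : Prop :=
  ∀ (F : Type u) [AddCommGroup F] [Module R F] [Module.FinitePresentation R F]
    (φ : F →ₗ[R] M ⧸ L), ∃ t : F →ₗ[R] M, L.mkQ ∘ₗ t = φ

/-- `M` is the `κ`-directed union of the family `S` of submodules: every subfamily of fewer than
`κ` members of `S` has an upper bound in `S`, and the members of `S` cover `M`. -/
def IsDirectedUnion (κ : Cardinal.{u}) (S : Set (Submodule R M)) : Prop :=
  (∀ T ⊆ S, #T < κ → ∃ L ∈ S, ∀ K ∈ T, K ≤ L) ∧ ∀ x : M, ∃ L ∈ S, x ∈ L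

end Modules

section HUnitaryModules

variable (A : Type u) [NonUnitalRing A]

/-- The unital ring `ℤ ⋉ A` obtained by adjoining an identity to `A`. Left modules over the
nonunital ring `A` are the same as (unital) left modules over this ring. -/
abbrev Unital : Type u := Unitization ℤ A

/-- The augmentation `ℤ ⋉ A → ℤ`, `(n, a) ↦ n`, as a ring homomorphism on the opposite ring. -/
def augmentationOp : (Unital A)ᵐᵒᵖ →+* ℤ :=
  (Unitization.fstHom ℤ A).toRingHom.fromOpposite fun _ _ => mul_comm _ _

/-- `ℤ` as a right `ℤ ⋉ A`-module on which `A` acts by zero. -/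
def trivialRightModule : ModuleCat.{0} (Unital A)ᵐᵒᵖ :=
  letI : Module (Unital A)ᵐᵒᵖ ℤ := Module.compHom ℤ (augmentationOp A)
  ModuleCat.of (Unital A)ᵐᵒᵖ ℤ

/-- A left `A`-module `M` is h-unitary if `Tor_n(ℤ, M) = 0` over `ℤ ⋉ A` for all `n ≥ 0`. -/
def isHUnitary : ObjectProperty (ModuleCat.{u} (Unital A)) :=
  fun M => ∀ n : ℕ, IsZero (tor n (trivialRightModule A) M)

/-- The category of h-unitary left `A`-modules, a full subcategory of all left `A`-modules. -/
abbrev HUnitaryModuleCat : Type (u + 1) := (isHUnitary A).FullSubcategory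

end HUnitaryModules

end HUnitary

end

noncomputable section

namespace HUnitary

/-! ### Elements of filtered colimits of modules -/

section FilteredColimits

/-! Tor is computed by a functorial free resolution: cover `M` by the free module on its underlying
set, pass to the kernel, repeat. The resulting complex `torRes` commutes with filtered colimits, and
by `isZero_tor_iff` the vanishing of `Tor_n` says elementwise that every cycle is a boundary.

Hence h-unitary modules are closed under filtered colimits, which are thus computed among all
modules. Over a ring of size at most `c`, a module of size at most `c` is `c⁺`-presentable, since a
homomorphism out of it consists of at most `c` values subject to at most `c` equations; this passes
to the full subcategory.

The directed union comes from a Löwenheim–Skolem argument (`exists_isPure_isZero_tor`). For a small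
submodule `N` of an h-unitary `M`, each of the at most `c` cycles over `N` bounds in `M`, hence in
some small submodule. Adjoin all these submodules, together with solutions of the finite linear
systems over `N` that are solvable in `M`. After `ω` rounds the union is small, h-unitary and pure.
Starting from a sum of at most `c` small submodules gives directedness; starting from a cyclic one
gives covering. As small h-unitary modules form a set up to isomorphism, accessibility follows.
Additivity holds because `Tor_n` is an additive functor. -/

instance forget_preservesColimitsOfShape_of_isFiltered (R : Type v) [Ring R] (J : Type u)
    [SmallCategory J] [IsFiltered J] : PreservesColimitsOfShape J (forget (ModuleCat.{u} R)) :=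
  inferInstanceAs (PreservesColimitsOfShape J
    (forget₂ (ModuleCat.{u} R) AddCommGrpCat.{u} ⋙ forget AddCommGrpCat.{u}))

variable {R : Type v} [Ring R] {J : Type u} [SmallCategory J] [IsFiltered J]
  {D : J ⥤ ModuleCat.{u} R}

theorem exists_rep_of_isColimit {c : Cocone D} (hc : IsColimit c) (x : c.pt) :
    ∃ (j : J) (y : D.obj j), c.ι.app j y = x :=
  Concrete.isColimit_exists_rep D hc x

theorem exists_map_eq_of_isColimit {c : Cocone D} (hc : IsColimit c) {j : J} {x y : D.obj j}
    (h : c.ι.app j x = c.ι.app j y) : ∃ (k : J) (f : j ⟶ k), D.map f x = D.map f y :=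
  (Types.FilteredColimit.isColimit_eq_iff' (isColimitOfPreserves (forget _) hc) x y).1 h

theorem exists_map_eq_zero_of_isColimit {c : Cocone D} (hc : IsColimit c) {j : J} {x : D.obj j}
    (h : c.ι.app j x = 0) : ∃ (k : J) (f : j ⟶ k), D.map f x = 0 := by
  obtain ⟨k, f, hf⟩ := exists_map_eq_of_isColimit hc (x := x) (y := 0) (by rw [h, map_zero])
  exact ⟨k, f, by rw [hf, map_zero]⟩

/-- A cocone of modules on a filtered diagram is a colimit if it is jointly surjective and every
element that becomes zero in it becomes zero in the diagram. -/
def isColimitOfSurjOfZero (c : Cocone D)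
    (hsurj : ∀ x : c.pt, ∃ (j : J) (y : D.obj j), c.ι.app j y = x)
    (hzero : ∀ (j : J) (y : D.obj j), c.ι.app j y = 0 → ∃ (k : J) (f : j ⟶ k), D.map f y = 0) :
    IsColimit c :=
  have : ReflectsColimit D (forget (ModuleCat.{u} R)) := reflectsColimit_of_reflectsIsomorphisms _ _
  isColimitOfReflects (forget _) <| Types.FilteredColimit.isColimitOf' _ _
    (fun x => by
      obtain ⟨j, y, rfl⟩ := hsurj x
      exact ⟨j, y, rfl⟩)
    (fun j x y h => by
      obtain ⟨k, f, hf⟩ := hzero j (x - y : D.obj j) (by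
        rw [map_sub, sub_eq_zero]; exact h)
      refine ⟨k, f, ?_⟩
      rw [map_sub, sub_eq_zero] at hf
      exact hf)

end FilteredColimits

/-! ### Tensor products commute with filtered colimits -/

section TensorColimits

variable {R : Type u} [Ring R]

theorem balancedTensor_mk_smul (X : Type v) [AddCommGroup X] [Module Rᵐᵒᵖ X]
    {M : Type u} [AddCommGroup M] [Module R M] (x : X) (r : R) (m : M) :
    (Submodule.Quotient.mk ((MulOpposite.op r • x) ⊗ₜ[ℤ] m) : BalancedTensor R X M) =
      Submodule.Quotient.mk (x ⊗ₜ[ℤ] (r • m)) :=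
  (Submodule.Quotient.eq _).2 (Submodule.subset_span ⟨x, r, m, rfl⟩)

theorem tensorFunctor_hom_ext {X : ModuleCat.{v} Rᵐᵒᵖ} {M : ModuleCat.{u} R}
    {P : ModuleCat.{max v u} ℤ} {f g : (tensorFunctor X).obj M ⟶ P}
    (h : ∀ (x : X) (m : M), f (Submodule.Quotient.mk (x ⊗ₜ[ℤ] m) : BalancedTensor R X M) =
      g (Submodule.Quotient.mk (x ⊗ₜ[ℤ] m) : BalancedTensor R X M)) : f = g := by
  ext t
  -- The `ℤ`-action bundled in `P` need not be definitionally that of its additive group, so the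
  -- comparison passes through additive maps.
  exact congr($(balancedTensor_hom_ext X (f := f.hom.toAddMonoidHom.toIntLinearMap)
    (g := g.hom.toAddMonoidHom.toIntLinearMap) h) t)

/-- The additive map `m ↦ x ⊗ m`. -/
def tmulHom (X : Type v) [AddCommGroup X] [Module Rᵐᵒᵖ X]
    (M : Type u) [AddCommGroup M] [Module R M] (x : X) : M →+ BalancedTensor R X M where
  toFun m := Submodule.Quotient.mk (x ⊗ₜ[ℤ] m)
  map_zero' := by simp
  map_add' m n := by rw [TensorProduct.tmul_add, Submodule.Quotient.mk_add]

/-- A map out of the balanced tensor product from a balanced biadditive map. -/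
def balancedLift {X : Type v} [AddCommGroup X] [Module Rᵐᵒᵖ X]
    {M : Type u} [AddCommGroup M] [Module R M] {P : Type*} [AddCommGroup P]
    (φ : X →+ M →+ P) (h : ∀ x (r : R) m, φ (MulOpposite.op r • x) m = φ x (r • m)) :
    BalancedTensor R X M →+ P :=
  (Submodule.liftQ _ (TensorProduct.liftAddHom φ (fun n x m => by simp)).toIntLinearMap <| by
    refine Submodule.span_le.2 ?_
    rintro _ ⟨x, r, m, rfl⟩
    simp [h]).toAddMonoidHom

variable (X : ModuleCat.{0} Rᵐᵒᵖ) {J : Type u} [SmallCategory J]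
  {D : J ⥤ ModuleCat.{u} R} {c : Cocone D}

/-- The cocone of additive maps `m ↦ x ⊗ m` given by a cocone under `X ⊗ D` and `x : X`. -/
def tensorCocone (s : Cocone (D ⋙ tensorFunctor X)) (x : X) :
    Cocone (D ⋙ forget₂ (ModuleCat.{u} R) AddCommGrpCat.{u}) where
  pt := AddCommGrpCat.of s.pt
  ι :=
    { app := fun j => AddCommGrpCat.ofHom
        ((s.ι.app j).hom.toAddMonoidHom.comp (tmulHom X (D.obj j) x))
      naturality := fun j k f => by
        ext m
        exact congr($(s.w f) (Submodule.Quotient.mk (x ⊗ₜ[ℤ] m) : BalancedTensor R X (D.obj j))) }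

/-- For a cocone under `X ⊗ D` and `x : X`, the map `m ↦ x ⊗ m` on the colimit of `D`. -/
def tensorDescAux (hc : IsColimit c) (s : Cocone (D ⋙ tensorFunctor X)) (x : X) :
    c.pt →+ s.pt :=
  ((isColimitOfPreserves (forget₂ (ModuleCat.{u} R) AddCommGrpCat.{u}) hc).desc
    (tensorCocone X s x)).hom

theorem tensorDescAux_apply (hc : IsColimit c) (s : Cocone (D ⋙ tensorFunctor X)) (x : X)
    (j : J) (m : D.obj j) :
    tensorDescAux X hc s x (c.ι.app j m) =
      s.ι.app j (Submodule.Quotient.mk (x ⊗ₜ[ℤ] m) : BalancedTensor R X (D.obj j)) :=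
  congr($((isColimitOfPreserves (forget₂ (ModuleCat.{u} R) AddCommGrpCat.{u}) hc).fac
    (tensorCocone X s x) j) m)

variable [IsFiltered J]

/-- The map out of `X ⊗ colim D` induced by a cocone under `X ⊗ D`. -/
def tensorDesc (hc : IsColimit c) (s : Cocone (D ⋙ tensorFunctor X)) :
    (tensorFunctor X).obj c.pt ⟶ s.pt :=
  -- Each `m ↦ x ⊗ m` descends separately; additivity in `x` and balancedness are then checked on
  -- representatives at one stage.
  let φ : BalancedTensor R X c.pt →+ s.pt :=
    balancedLift (AddMonoidHom.mk' (tensorDescAux X hc s) fun x y => by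
      ext m
      obtain ⟨j, m, rfl⟩ := exists_rep_of_isColimit hc m
      rw [AddMonoidHom.add_apply]
      simp only [tensorDescAux_apply]
      rw [TensorProduct.add_tmul, Submodule.Quotient.mk_add]
      exact map_add (s.ι.app j).hom _ _) fun x r m => by
    obtain ⟨j, m, rfl⟩ := exists_rep_of_isColimit hc m
    simp only [AddMonoidHom.mk'_apply]
    rw [← map_smul]
    simp only [tensorDescAux_apply]
    rw [balancedTensor_mk_smul]
  ModuleCat.ofHom
    { φ with map_smul' := fun n t => by simpa using map_intCast_smul φ ℤ ℤ n t }

/-- `X ⊗ -` sends colimits of filtered diagrams to colimits. -/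
def isColimitTensor (hc : IsColimit c) : IsColimit ((tensorFunctor X).mapCocone c) where
  desc s := tensorDesc X hc s
  fac s j := tensorFunctor_hom_ext fun x m => tensorDescAux_apply X hc s x j m
  uniq s f hf := by
    refine tensorFunctor_hom_ext fun x m => ?_
    obtain ⟨j, m, rfl⟩ := exists_rep_of_isColimit hc m
    refine Eq.trans ?_ (tensorDescAux_apply X hc s x j m).symm
    exact congr($(hf j) (Submodule.Quotient.mk (x ⊗ₜ[ℤ] m) : BalancedTensor R X (D.obj j)))

instance tensorFunctor_preservesColimitsOfShape :
    PreservesColimitsOfShape J (tensorFunctor X : ModuleCat.{u} R ⥤ _) where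
  preservesColimit := ⟨fun hc => ⟨isColimitTensor X hc⟩⟩

end TensorColimits

/-! ### Elementwise homology and projective resolutions -/

section ChainComplexes

variable {R : Type v} [Ring R]

theorem isZero_homology_succ_iff (K : ChainComplex (ModuleCat.{u} R) ℕ) (n : ℕ) :
    IsZero (K.homology (n + 1)) ↔
      ∀ y : K.X (n + 1), K.d (n + 1) n y = 0 → ∃ z : K.X (n + 2), K.d (n + 2) (n + 1) z = y := by
  rw [← HomologicalComplex.exactAt_iff_isZero_homology,
    HomologicalComplex.exactAt_iff' _ (n + 1 + 1) (n + 1) n (by simp) (by simp),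
    ShortComplex.moduleCat_exact_iff]
  rfl

theorem isZero_homology_zero_iff (K : ChainComplex (ModuleCat.{u} R) ℕ) :
    IsZero (K.homology 0) ↔ ∀ y : K.X 0, ∃ z : K.X 1, K.d 1 0 z = y := by
  rw [← HomologicalComplex.exactAt_iff_isZero_homology,
    HomologicalComplex.exactAt_iff' _ 1 0 0 (by simp) (by simp),
    ShortComplex.moduleCat_exact_iff]
  have h (y : K.X 0) : K.d 0 0 y = 0 := by simp
  exact ⟨fun H y => H y (h y), fun H y _ => H y⟩

/-- A projective resolution from elementwise exactness of an augmented chain complex. -/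
def projectiveResolutionOfExact (K : ChainComplex (ModuleCat.{u} R) ℕ)
    (hK : ∀ n, Projective (K.X n)) {M : ModuleCat.{u} R} (ε : K.X 0 ⟶ M) (w : K.d 1 0 ≫ ε = 0)
    (hε : Function.Surjective ε) (h0 : ∀ y, ε y = 0 → ∃ z, K.d 1 0 z = y)
    (hsucc : ∀ n y, K.d (n + 1) n y = 0 → ∃ z, K.d (n + 2) (n + 1) z = y) :
    ProjectiveResolution M where
  complex := K
  projective := hK
  π := (ChainComplex.toSingle₀Equiv _ _).symm ⟨ε, w⟩
  quasiIso := ⟨fun n => by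
    cases n with
    | zero =>
      rw [ChainComplex.quasiIsoAt₀_iff, ShortComplex.quasiIso_iff_of_zeros']
      · refine (ShortComplex.exact_and_epi_g_iff_of_iso (S₂ := ShortComplex.mk _ _ w) ?_).2
          ⟨(ShortComplex.moduleCat_exact_iff _).2 h0, (ModuleCat.epi_iff_surjective _).2 hε⟩
        exact ShortComplex.isoMk (Iso.refl _) (Iso.refl _) (Iso.refl _)
          ((Category.id_comp _).trans (Category.comp_id _).symm)
          ((Category.id_comp _).trans (Category.comp_id _).symm)
      · exact K.shape 0 0 (by simp)
      all_goals rfl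
    | succ n =>
      rw [quasiIsoAt_iff_exactAt']
      · rw [HomologicalComplex.exactAt_iff_isZero_homology, isZero_homology_succ_iff]
        exact hsucc n
      · apply ChainComplex.exactAt_succ_single_obj⟩

end ChainComplexes

/-! ### The functorial free resolution -/

section FreeResolution

variable (R : Type u) [Ring R]

/-- The functor sending a module to the free module on its underlying set. -/
abbrev freeOn : ModuleCat.{u} R ⥤ ModuleCat.{u} R :=
  forget (ModuleCat.{u} R) ⋙ ModuleCat.free R

/-- The canonical surjection from the free module on `M` onto `M`. -/
def freeOnπ : freeOn R ⟶ 𝟭 (ModuleCat.{u} R) := (ModuleCat.adj R).counit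

variable {R}

theorem freeOnπ_surjective (M : ModuleCat.{u} R) : Function.Surjective ((freeOnπ R).app M) :=
  fun m => ⟨ModuleCat.freeMk m, by simp [freeOnπ, ModuleCat.adj, ModuleCat.freeHomEquiv]⟩

/-- The functorial first syzygy module, the kernel of the canonical surjection from the free
module on `M` onto `M`. -/
def syzygy : ModuleCat.{u} R ⥤ ModuleCat.{u} R where
  obj M := ModuleCat.of R (LinearMap.ker ((freeOnπ R).app M).hom)
  map {M N} f := ModuleCat.ofHom <| ((freeOn R).map f).hom.restrict fun x hx => by
    rw [LinearMap.mem_ker] at hx ⊢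
    have := congr($((freeOnπ R).naturality f) x)
    exact this.trans ((congrArg f.hom hx).trans (map_zero f.hom))
  map_id M := by
    refine ModuleCat.hom_ext (LinearMap.ext fun x => Subtype.ext ?_)
    exact congr(($((freeOn R).map_id M)).hom x.1)
  map_comp f g := by
    refine ModuleCat.hom_ext (LinearMap.ext fun x => Subtype.ext ?_)
    exact congr(($((freeOn R).map_comp f g)).hom x.1)

/-- The inclusion of the first syzygy module into the free module on `M`. -/
def syzygyι : syzygy ⟶ freeOn R where
  app M := ModuleCat.ofHom (LinearMap.ker ((freeOnπ R).app M).hom).subtype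

theorem syzygyι_injective (M : ModuleCat.{u} R) : Function.Injective (syzygyι.app M) :=
  Subtype.val_injective

theorem freeOnπ_syzygyι (M : ModuleCat.{u} R) (x : syzygy.obj M) :
    (freeOnπ R).app M (syzygyι.app M x) = 0 := x.2

theorem exists_syzygyι_eq {M : ModuleCat.{u} R} {y : (freeOn R).obj M}
    (hy : (freeOnπ R).app M y = 0) : ∃ x, syzygyι.app M x = y := ⟨⟨y, hy⟩, rfl⟩

/-- The functorial `n`-th syzygy module. -/
def syzygies : ℕ → (ModuleCat.{u} R ⥤ ModuleCat.{u} R)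
  | 0 => 𝟭 _
  | n + 1 => syzygies n ⋙ syzygy

/-- The functorial free resolution in degree `n`. -/
abbrev freeRes (n : ℕ) : ModuleCat.{u} R ⥤ ModuleCat.{u} R := syzygies n ⋙ freeOn R

/-- The differential of the functorial free resolution. -/
def freeResD (n : ℕ) : freeRes (R := R) (n + 1) ⟶ freeRes n :=
  Functor.whiskerLeft (syzygies n) (Functor.whiskerLeft syzygy (freeOnπ R) ≫ syzygyι)

theorem freeResD_app (n : ℕ) (M : ModuleCat.{u} R) :
    (freeResD n).app M = (freeOnπ R).app (syzygy.obj ((syzygies n).obj M)) ≫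
      syzygyι.app ((syzygies n).obj M) := rfl

theorem freeResD_eq_zero_iff (n : ℕ) (M : ModuleCat.{u} R) (x : (freeRes (n + 1)).obj M) :
    (freeResD n).app M x = 0 ↔ (freeOnπ R).app (syzygy.obj ((syzygies n).obj M)) x = 0 :=
  map_eq_zero_iff (syzygyι.app ((syzygies n).obj M)).hom (syzygyι_injective _)

theorem freeOnπ_freeResD (n : ℕ) (M : ModuleCat.{u} R) :
    (freeResD n).app M ≫ (freeOnπ R).app ((syzygies n).obj M) = 0 := by
  ext x
  exact freeOnπ_syzygyι _ _

theorem exists_freeResD_eq (n : ℕ) (M : ModuleCat.{u} R) (x : (freeRes n).obj M)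
    (hx : (freeOnπ R).app ((syzygies n).obj M) x = 0) : ∃ y, (freeResD n).app M y = x := by
  obtain ⟨z, rfl⟩ := exists_syzygyι_eq hx
  obtain ⟨y, rfl⟩ := freeOnπ_surjective _ z
  exact ⟨y, rfl⟩

theorem freeResD_comp (n : ℕ) (M : ModuleCat.{u} R) :
    (freeResD (n + 1)).app M ≫ (freeResD n).app M = 0 := by
  rw [freeResD_app n]
  exact (Category.assoc _ _ _).symm.trans ((congrArg (· ≫ _) (freeOnπ_freeResD (n + 1) M)).trans
    zero_comp)

/-- The functorial free resolution of `M` as a chain complex. -/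
def freeResComplex (M : ModuleCat.{u} R) : ChainComplex (ModuleCat.{u} R) ℕ :=
  ChainComplex.of (fun n => (freeRes n).obj M) (fun n => (freeResD n).app M) 
    fun n => freeResD_comp n M

theorem freeResComplex_d (M : ModuleCat.{u} R) (n : ℕ) :
    (freeResComplex M).d (n + 1) n = (freeResD n).app M :=
  ChainComplex.of_d (fun n => (freeRes n).obj M) (fun n => (freeResD n).app M) n

theorem freeResComplex_d_apply (M : ModuleCat.{u} R) (n : ℕ) (x : (freeRes (n + 1)).obj M) :
    (freeResComplex M).d (n + 1) n x = (freeResD n).app M x :=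
  congr(($(freeResComplex_d M n)).hom x)

/-- The functorial free resolution. -/
def freeResolution (M : ModuleCat.{u} R) : ProjectiveResolution M :=
  projectiveResolutionOfExact (freeResComplex M)
    (fun n => (ModuleCat.projective_of_free
      (M := (freeRes n).obj M) (Finsupp.basisSingleOne (R := R) (ι := (syzygies n).obj M))))
    ((freeOnπ R).app M) (by rw [freeResComplex_d]; exact freeOnπ_freeResD 0 M)
    (freeOnπ_surjective M)
    (fun y hy => by
      obtain ⟨z, hz⟩ := exists_freeResD_eq 0 M y hy
      exact ⟨z, (freeResComplex_d_apply M 0 z).trans hz⟩)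
    fun n y hy => by
      obtain ⟨z, hz⟩ := exists_freeResD_eq (n + 1) M y
        ((freeResD_eq_zero_iff n M y).1 ((freeResComplex_d_apply M n y).symm.trans hy))
      exact ⟨z, (freeResComplex_d_apply M (n + 1) z).trans hz⟩

end FreeResolution

/-! ### Vanishing of Tor through cycles and boundaries -/

section TorCriterion

variable {R : Type u} [Ring R] (X : ModuleCat.{0} Rᵐᵒᵖ)

/-- The functorial complex computing `Tor`, in degree `n`. -/
abbrev torRes (n : ℕ) : ModuleCat.{u} R ⥤ ModuleCat.{u} ℤ := freeRes n ⋙ tensorFunctor X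

/-- The differential of the functorial complex computing `Tor`. -/
def torResD (n : ℕ) : torRes X (n + 1) ⟶ torRes X n := Functor.whiskerRight (freeResD n) _

/-- `y` is a cycle of degree `n`. -/
def IsTorCycle {M : ModuleCat.{u} R} : (n : ℕ) → (torRes X n).obj M → Prop
  | 0, _ => True
  | n + 1, y => (torResD X n).app M y = 0

/-- Derived functors may be computed from any projective resolution; the functorial one lets cycles
and boundaries be transported along homomorphisms. In degree 0 every element is a cycle. -/
theorem isZero_tor_iff (n : ℕ) (M : ModuleCat.{u} R) :
    IsZero (tor n X M) ↔ ∀ y : (torRes X n).obj M, IsTorCycle X n y →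
      ∃ z, (torResD X n).app M z = y := by
  have hd (n : ℕ) (x : (torRes X (n + 1)).obj M) :
      (((tensorFunctor X).mapHomologicalComplex _).obj (freeResComplex M)).d (n + 1) n x =
        (torResD X n).app M x :=
    congr(((tensorFunctor X).map $(freeResComplex_d M n)).hom x)
  let K := ((tensorFunctor X).mapHomologicalComplex (ComplexShape.down ℕ)).obj (freeResComplex M)
  refine ((freeResolution M).isoLeftDerivedObj (tensorFunctor X) n).isZero_iff.trans ?_
  cases n with
  | zero =>
    refine (isZero_homology_zero_iff K).trans ⟨fun H y _ => ?_, fun H y => ?_⟩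
    · obtain ⟨z, hz⟩ := H y
      exact ⟨z, (hd 0 z).symm.trans hz⟩
    · obtain ⟨z, hz⟩ := H y trivial
      exact ⟨z, (hd 0 z).trans hz⟩
  | succ n =>
    refine (isZero_homology_succ_iff K n).trans ⟨fun H y hy => ?_, fun H y hy => ?_⟩
    · obtain ⟨z, hz⟩ := H y ((hd n y).trans hy)
      exact ⟨z, (hd (n + 1) z).symm.trans hz⟩
    · obtain ⟨z, hz⟩ := H y ((hd n y).symm.trans hy)
      exact ⟨z, (hd (n + 1) z).trans hz⟩

end TorCriterion

/-! ### Syzygies commute with filtered colimits -/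

section ResolutionColimits

variable {R : Type u} [Ring R] {J : Type u} [SmallCategory J] [IsFiltered J]

instance freeOn_preservesColimitsOfShape : PreservesColimitsOfShape J (freeOn R) := by
  have : PreservesColimitsOfShape J (ModuleCat.free R) :=
    (ModuleCat.adj R).leftAdjoint_preservesColimits.preservesColimitsOfShape
  infer_instance

/-- The first syzygy functor sends colimits of filtered diagrams to colimits. -/
def isColimitSyzygy {D : J ⥤ ModuleCat.{u} R} {c : Cocone D} (hc : IsColimit c) :
    IsColimit (syzygy.mapCocone c) := by
  have hι {M N : ModuleCat.{u} R} (f : M ⟶ N) (x : syzygy.obj M) :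
      syzygyι.app N (syzygy.map f x) = (freeOn R).map f (syzygyι.app M x) := rfl
  have hπ {M N : ModuleCat.{u} R} (f : M ⟶ N) (x : (freeOn R).obj M) :
      (freeOnπ R).app N ((freeOn R).map f x) = f ((freeOnπ R).app M x) :=
    congr(($((freeOnπ R).naturality f)).hom x)
  refine isColimitOfSurjOfZero _ (fun x => ?_) fun j y hy => ?_
  · obtain ⟨j, y, hy⟩ := exists_rep_of_isColimit (isColimitOfPreserves (freeOn R) hc)
      (syzygyι.app c.pt x)
    -- The representative `y` need not be a syzygy at stage `j`, but its image in `D.obj j` dies in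
    -- the colimit, hence at a later stage.
    obtain ⟨k, f, hf⟩ := exists_map_eq_zero_of_isColimit hc (x := (freeOnπ R).app _ y) (by
      refine (hπ (c.ι.app j) y).symm.trans ((congrArg _ hy).trans (freeOnπ_syzygyι c.pt x)))
    obtain ⟨z, hz⟩ := exists_syzygyι_eq (y := (freeOn R).map (D.map f) y)
      ((hπ (D.map f) y).trans hf)
    refine ⟨k, z, syzygyι_injective c.pt ?_⟩
    refine (hι (c.ι.app k) z).trans ((congrArg _ hz).trans (Eq.trans ?_ hy))
    exact congr(($(((freeOn R).mapCocone c).w f)).hom y)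
  · obtain ⟨k, f, hf⟩ := exists_map_eq_zero_of_isColimit (isColimitOfPreserves (freeOn R) hc)
      (x := syzygyι.app (D.obj j) y)
      ((hι (c.ι.app j) y).symm.trans ((congrArg _ hy).trans (map_zero (syzygyι.app c.pt).hom)))
    exact ⟨k, f, syzygyι_injective _
      ((hι (D.map f) y).trans (hf.trans (map_zero (syzygyι.app (D.obj k)).hom).symm))⟩

instance syzygy_preservesColimitsOfShape : PreservesColimitsOfShape J (syzygy (R := R)) where
  preservesColimit := ⟨fun hc => ⟨isColimitSyzygy hc⟩⟩

instance syzygies_preservesColimitsOfShape (n : ℕ) :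
    PreservesColimitsOfShape J (syzygies (R := R) n) := by
  induction n with
  | zero => exact inferInstanceAs (PreservesColimitsOfShape J (𝟭 _))
  | succ n ih => exact inferInstanceAs (PreservesColimitsOfShape J (syzygies n ⋙ syzygy))

end ResolutionColimits

/-! ### Tor and filtered colimits -/

section TorColimits

variable {R : Type u} [Ring R] (X : ModuleCat.{0} Rᵐᵒᵖ) {J : Type u} [SmallCategory J]
  {D : J ⥤ ModuleCat.{u} R} {c : Cocone D}

theorem torResD_naturality (n : ℕ) {M N : ModuleCat.{u} R} (f : M ⟶ N)
    (x : (torRes X (n + 1)).obj M) :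
    (torResD X n).app N ((torRes X (n + 1)).map f x) =
      (torRes X n).map f ((torResD X n).app M x) :=
  congr(($((torResD X n).naturality f)).hom x)

theorem torRes_map_comp (n : ℕ) {L M N : ModuleCat.{u} R} (f : L ⟶ M) (g : M ⟶ N)
    (x : (torRes X n).obj L) :
    (torRes X n).map (f ≫ g) x = (torRes X n).map g ((torRes X n).map f x) :=
  congr(($((torRes X n).map_comp f g)).hom x)

theorem IsTorCycle.map {n : ℕ} {M N : ModuleCat.{u} R} (f : M ⟶ N) {x : (torRes X n).obj M}
    (hx : IsTorCycle X n x) : IsTorCycle X n ((torRes X n).map f x) := by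
  cases n with
  | zero => trivial
  | succ n =>
    exact (torResD_naturality X n f x).trans
      ((congrArg _ hx).trans (map_zero ((torRes X n).map f).hom))

variable [IsFiltered J]

theorem exists_torRes_rep (hc : IsColimit c) (n : ℕ) (x : (torRes X n).obj c.pt) :
    ∃ (j : J) (y : (torRes X n).obj (D.obj j)), (torRes X n).map (c.ι.app j) y = x :=
  exists_rep_of_isColimit (isColimitOfPreserves (torRes X n) hc) x

theorem exists_torRes_map_eq (hc : IsColimit c) (n : ℕ) {j : J}
    {x y : (torRes X n).obj (D.obj j)}
    (h : (torRes X n).map (c.ι.app j) x = (torRes X n).map (c.ι.app j) y) :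
    ∃ (k : J) (f : j ⟶ k), (torRes X n).map (D.map f) x = (torRes X n).map (D.map f) y :=
  exists_map_eq_of_isColimit (isColimitOfPreserves (torRes X n) hc) h

/-- The differential of an arbitrary representative vanishes in the colimit, hence at a later stage,
where the representative becomes a cycle. -/
theorem exists_isTorCycle_rep (hc : IsColimit c) (n : ℕ) {x : (torRes X n).obj c.pt}
    (hx : IsTorCycle X n x) :
    ∃ (j : J) (y : (torRes X n).obj (D.obj j)), IsTorCycle X n y ∧
      (torRes X n).map (c.ι.app j) y = x := by
  obtain ⟨j, y, hy⟩ := exists_torRes_rep X hc n x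
  cases n with
  | zero => exact ⟨j, y, trivial, hy⟩
  | succ n =>
    obtain ⟨k, f, hf⟩ := exists_torRes_map_eq X hc n (x := (torResD X n).app _ y) (y := 0) (by
      rw [← torResD_naturality, hy, map_zero]
      exact hx)
    refine ⟨k, (torRes X (n + 1)).map (D.map f) y, ?_, ?_⟩
    · exact (torResD_naturality X n (D.map f) y).trans (hf.trans (map_zero _))
    · rw [← torRes_map_comp, c.w, hy]

/-- A cycle of some member of a filtered diagram that becomes a boundary in the colimit becomes a
boundary in the diagram. -/
theorem exists_torBoundary (hc : IsColimit c) (n : ℕ) {j : J} (y : (torRes X n).obj (D.obj j))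
    (z : (torRes X (n + 1)).obj c.pt)
    (h : (torResD X n).app c.pt z = (torRes X n).map (c.ι.app j) y) :
    ∃ (k : J) (f : j ⟶ k) (w : (torRes X (n + 1)).obj (D.obj k)),
      (torResD X n).app _ w = (torRes X n).map (D.map f) y := by
  obtain ⟨i, w, rfl⟩ := exists_torRes_rep X hc (n + 1) z
  obtain ⟨k, f, g, -⟩ := IsFilteredOrEmpty.cocone_objs i j
  have := exists_torRes_map_eq X hc n (j := k)
    (x := (torResD X n).app _ ((torRes X (n + 1)).map (D.map f) w))
    (y := (torRes X n).map (D.map g) y) (by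
      refine (torResD_naturality X n (c.ι.app k) _).symm.trans ?_
      rw [← torRes_map_comp, ← torRes_map_comp, c.w, c.w]
      exact h)
  obtain ⟨l, e, he⟩ := this
  refine ⟨l, g ≫ e, (torRes X (n + 1)).map (D.map e) ((torRes X (n + 1)).map (D.map f) w), ?_⟩
  rw [torResD_naturality, he, D.map_comp, torRes_map_comp]

theorem isZero_tor_of_isColimit (hc : IsColimit c) (n : ℕ) (h : ∀ j, IsZero (tor n X (D.obj j))) :
    IsZero (tor n X c.pt) := by
  rw [isZero_tor_iff]
  intro x hx
  obtain ⟨j, y, hy, rfl⟩ := exists_isTorCycle_rep X hc n hx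
  obtain ⟨z, rfl⟩ := (isZero_tor_iff X n _).1 (h j) y hy
  exact ⟨_, torResD_naturality X n _ z⟩

end TorColimits

/-! ### Closure properties of h-unitary modules -/

section HUnitaryClosure

/-- The sum of lifts of `f` and `g` to resolutions is a lift of `f + g`, and any lift computes the
derived map. -/
theorem leftDerived_additive {C : Type*} [Category* C] [Abelian C] [HasProjectiveResolutions C]
    {D : Type*} [Category* D] [Abelian D] (F : C ⥤ D) [F.Additive] (n : ℕ) :
    (F.leftDerived n).Additive where
  map_add {X Y f g} := by
    let P := projectiveResolution X
    let Q := projectiveResolution Y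
    have hf := ProjectiveResolution.lift_commutes f P Q
    have hg := ProjectiveResolution.lift_commutes g P Q
    rw [F.leftDerived_map_eq n f _ hf, F.leftDerived_map_eq n g _ hg,
      F.leftDerived_map_eq n (f + g) (ProjectiveResolution.lift f P Q +
        ProjectiveResolution.lift g P Q) (by
          rw [Preadditive.add_comp, hf, hg, Functor.map_add, Preadditive.comp_add]),
      Functor.map_add, Preadditive.add_comp, Preadditive.comp_add]

variable (A : Type u) [NonUnitalRing A]

instance isHUnitary_isClosedUnderFilteredColimits (J : Type u) [SmallCategory J] [IsFiltered J] :
    (isHUnitary A).IsClosedUnderColimitsOfShape J where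
  colimitsOfShape_le := by
    rintro M ⟨p⟩ n
    exact isZero_tor_of_isColimit _ p.isColimit n fun j => p.prop_diag_obj j n

instance isHUnitary_isClosedUnderFiniteProducts (J : Type) [Finite J] :
    (isHUnitary A).IsClosedUnderLimitsOfShape (Discrete J) where
  limitsOfShape_le := by
    rintro M ⟨p⟩ n
    have : PreservesFiniteProducts ((tensorFunctor (trivialRightModule A)).leftDerived n) := by
      have := leftDerived_additive (tensorFunctor (trivialRightModule A) : ModuleCat.{u} _ ⥤ _) n
      infer_instance
    rw [IsZero.iff_id_eq_zero]
    exact (isLimitOfPreserves ((tensorFunctor (trivialRightModule A)).leftDerived n)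
      p.isLimit).hom_ext fun j => (p.prop_diag_obj j n).eq_of_tgt _ _

theorem hasFiniteBiproducts_hUnitaryModuleCat : HasFiniteBiproducts (HUnitaryModuleCat A) := by
  have : HasFiniteProducts (HUnitaryModuleCat A) := ⟨fun n => inferInstance⟩
  exact HasFiniteBiproducts.of_hasFiniteProducts

end HUnitaryClosure

/-! ### Presentability of small modules -/

section Presentable

variable {R : Type u} [Ring R] (κ : Cardinal.{u}) [Fact κ.IsRegular]

/-- Each equation holds at a stage of its own; `κ`-filteredness merges fewer than `κ` such stages,
with a single composite arrow out of `j`. -/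
theorem exists_forall_map_eq_of_isColimit {J : Type u} [SmallCategory J]
    [IsCardinalFiltered J κ] {D : J ⥤ ModuleCat.{u} R} {c : Cocone D} (hc : IsColimit c) {j : J}
    {ι : Type u} (hι : #ι < κ) (x y : ι → D.obj j)
    (h : ∀ i, c.ι.app j (x i) = c.ι.app j (y i)) :
    ∃ (k : J) (f : j ⟶ k), ∀ i, D.map f (x i) = D.map f (y i) := by
  have := isFiltered_of_isCardinalFiltered J κ
  choose k f hf using fun i => exists_map_eq_of_isColimit hc (h i)
  obtain ⟨l, a, b, hab⟩ :=
    IsCardinalFiltered.wideSpan f ((hasCardinalLT_iff_cardinal_mk_lt ι κ).2 hι)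
  refine ⟨l, b, fun i => ?_⟩
  rw [← hab i, D.map_comp, ConcreteCategory.comp_apply, ConcreteCategory.comp_apply, hf]

theorem exists_forall_rep_of_isColimit {J : Type u} [SmallCategory J]
    [IsCardinalFiltered J κ] {D : J ⥤ ModuleCat.{u} R} {c : Cocone D} (hc : IsColimit c)
    {ι : Type u} (hι : #ι < κ) (x : ι → c.pt) :
    ∃ (j : J) (y : ι → D.obj j), ∀ i, c.ι.app j (y i) = x i := by
  have := isFiltered_of_isCardinalFiltered J κ
  choose j y hy using fun i => exists_rep_of_isColimit hc (x i)
  have hι' := (hasCardinalLT_iff_cardinal_mk_lt ι κ).2 hι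
  refine ⟨_, fun i => D.map (IsCardinalFiltered.toMax j hι' i) (y i), fun i => ?_⟩
  rw [← hy i, ← ConcreteCategory.comp_apply, c.w]

variable {κ}

/-- A module of cardinality less than `κ` over a ring of cardinality less than `κ` is
`κ`-presentable. -/
theorem isCardinalPresentable_of_card_lt (M : ModuleCat.{u} R) (hR : #R < κ) (hM : #M < κ) :
    IsCardinalPresentable M κ where
  preservesColimitOfShape J _ _ := by
    have := isFiltered_of_isCardinalFiltered J κ
    have hκ : ℵ₀ ≤ κ := (Fact.out : κ.IsRegular).aleph0_le
    refine ⟨fun {D} => ⟨fun {c} hc => ⟨?_⟩⟩⟩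
    refine Types.FilteredColimit.isColimitOf' _ _ (fun (f : M ⟶ c.pt) => ?_)
      fun j (f : M ⟶ D.obj j) (g : M ⟶ D.obj j) h => ?_
    · obtain ⟨i, y, hy⟩ := exists_forall_rep_of_isColimit κ hc hM f
      -- So far `y` is only a map of sets. This type indexes the additivity and scalar equations,
      -- few enough to hold together at one later stage.
      have hT : #((M × M) ⊕ (R × M)) < κ := by
        simp only [mk_sum, mk_prod, lift_id]
        exact add_lt_of_lt hκ (mul_lt_of_lt hκ hM hM) (mul_lt_of_lt hκ hR hM)
      obtain ⟨k, e, he⟩ := exists_forall_map_eq_of_isColimit κ hc hT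
        (Sum.elim (fun p => y (p.1 + p.2)) fun p => y (p.1 • p.2))
        (Sum.elim (fun p => y p.1 + y p.2) fun p => p.1 • y p.2) (by
          rintro (p | p) <;> simp [hy])
      refine ⟨k, ModuleCat.ofHom
        { toFun := fun m => D.map e (y m)
          map_add' := fun m n => (he (Sum.inl (m, n))).trans (map_add _ _ _)
          map_smul' := fun r m => (he (Sum.inr (r, m))).trans (map_smul _ _ _) }, ?_⟩
      refine ModuleCat.hom_ext (LinearMap.ext fun m => ?_)
      refine (hy m).symm.trans ?_
      exact congr(($(c.w e)).hom (y m)).symm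
    · obtain ⟨k, e, he⟩ := exists_forall_map_eq_of_isColimit κ hc hM f g fun m => congr(($h).hom m)
      exact ⟨k, e, ModuleCat.hom_ext (LinearMap.ext he)⟩

end Presentable

/-! ### Directed unions of submodules as colimits -/

section SubmoduleDiagrams

variable {R : Type u} [Ring R] {J : Type u}

/-- A cocone of modules on a filtered diagram is a colimit if it is jointly surjective with
injective structure maps. -/
def isColimitOfSurjOfInjective [SmallCategory J] [IsFiltered J] {D : J ⥤ ModuleCat.{u} R}
    (c : Cocone D) (hsurj : ∀ x : c.pt, ∃ (j : J) (y : D.obj j), c.ι.app j y = x)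
    (hinj : ∀ j, Function.Injective (c.ι.app j)) : IsColimit c :=
  isColimitOfSurjOfZero c hsurj fun j y hy =>
    ⟨j, 𝟙 j, by rw [hinj j (hy.trans (map_zero (c.ι.app j).hom).symm), map_zero]⟩

variable [Preorder J] {M : ModuleCat.{u} R} (g : J →o Submodule R M)

/-- A monotone family of submodules as a diagram. -/
def submoduleDiagram : J ⥤ ModuleCat.{u} R where
  obj j := ModuleCat.of R (g j)
  map f := ModuleCat.ofHom (Submodule.inclusion (g.monotone (leOfHom f)))

/-- The cocone from a monotone family of submodules to the ambient module. -/
def submoduleCocone : Cocone (submoduleDiagram g) where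
  pt := M
  ι := { app := fun j => ModuleCat.ofHom (g j).subtype }

/-- The cocone from a monotone family of submodules to a submodule containing them. -/
def submoduleCoconeOfLE (L : Submodule R M) (h : ∀ j, g j ≤ L) : Cocone (submoduleDiagram g) where
  pt := ModuleCat.of R L
  ι := { app := fun j => ModuleCat.ofHom (Submodule.inclusion (h j)) }

variable [IsFiltered J]

/-- A module is the colimit of a directed family of submodules covering it. -/
def isColimitSubmoduleCocone (hg : ∀ x : M, ∃ j, x ∈ g j) : IsColimit (submoduleCocone g) :=
  isColimitOfSurjOfInjective _
    (fun x => by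
      obtain ⟨j, hj⟩ := hg x
      exact ⟨j, (⟨x, hj⟩ : g j), rfl⟩)
    fun _ => Subtype.val_injective

/-- A submodule is the colimit of a directed family of submodules covering it. -/
def isColimitSubmoduleCoconeOfLE (L : Submodule R M) (h : ∀ j, g j ≤ L)
    (hg : ∀ x ∈ L, ∃ j, x ∈ g j) : IsColimit (submoduleCoconeOfLE g L h) :=
  isColimitOfSurjOfInjective _
    (fun x => by
      obtain ⟨j, hj⟩ := hg x.1 x.2
      exact ⟨j, (⟨x.1, hj⟩ : g j), rfl⟩)
    fun j => Submodule.inclusion_injective (h j)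

end SubmoduleDiagrams

/-! ### Cardinality bounds -/

section Cardinality

variable {c : Cardinal.{u}}

/-- Finite lists of pairs (scalar, generator) exhaust the span. Indexing scalars by `T` allows `S`
to live in another universe, as `ℤ` does. -/
theorem mk_span_le_of_surjective {S : Type v} [Semiring S] {N T : Type u} [AddCommMonoid N]
    [Module S N] (hc : ℵ₀ ≤ c) (e : T → S) (he : Function.Surjective e) (hT : #T ≤ c) (s : Set N)
    (hs : #s ≤ c) : #(Submodule.span S s) ≤ c := by
  let φ : List (T × s) → N := fun l => (l.map fun p => e p.1 • (p.2 : N)).sum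
  have hφ : (Submodule.span S s : Set N) ⊆ Set.range φ := by
    intro x hx
    induction hx using Submodule.span_induction with
    | mem x hx =>
      obtain ⟨t, ht⟩ := he 1
      exact ⟨[(t, ⟨x, hx⟩)], by simp [φ, ht]⟩
    | zero => exact ⟨[], rfl⟩
    | add x y _ _ hx hy =>
      obtain ⟨l, rfl⟩ := hx
      obtain ⟨l', rfl⟩ := hy
      exact ⟨l ++ l', by simp [φ]⟩
    | smul a x _ hx =>
      obtain ⟨l, rfl⟩ := hx
      refine ⟨l.map fun p => ((he (a * e p.1)).choose, p.2), ?_⟩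
      simp only [φ, List.map_map, List.smul_sum]
      congr 1
      refine List.map_congr_left fun p _ => ?_
      simp [(he (a * e p.1)).choose_spec, mul_smul]
  refine (mk_le_mk_of_subset hφ).trans (mk_range_le.trans ((mk_list_le_max _).trans ?_))
  refine max_le hc ?_
  rw [mk_prod, lift_id, lift_id]
  exact mul_le_of_le hc hT hs

theorem mk_le_of_span_eq_top {S : Type v} [Semiring S] {N T : Type u} [AddCommMonoid N]
    [Module S N] (hc : ℵ₀ ≤ c) (e : T → S) (he : Function.Surjective e) (hT : #T ≤ c) (s : Set N)
    (hs : #s ≤ c) (h : ∀ x, x ∈ Submodule.span S s) : #N ≤ c :=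
  (mk_le_of_injective (f := fun x : N => (⟨x, h x⟩ : Submodule.span S s))
    fun _ _ hxy => congrArg Subtype.val hxy).trans (mk_span_le_of_surjective hc e he hT s hs)

variable {R : Type u} [Ring R]

theorem mk_iSup_submodule_le {M : Type u} [AddCommGroup M] [Module R M] (hc : ℵ₀ ≤ c)
    (hR : #R ≤ c) {ι : Type u} (hι : #ι ≤ c) (N : ι → Submodule R M) (hN : ∀ i, #(N i) ≤ c) :
    #(⨆ i, N i : Submodule R M) ≤ c := by
  rw [Submodule.iSup_eq_span]
  refine mk_span_le_of_surjective hc id Function.surjective_id hR _ ((mk_iUnion_le _).trans ?_)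
  exact mul_le_of_le hc hι (ciSup_le' hN)

theorem mk_sup_submodule_le {M : Type u} [AddCommGroup M] [Module R M] (hc : ℵ₀ ≤ c)
    (hR : #R ≤ c) (N N' : Submodule R M) (hN : #N ≤ c) (hN' : #N' ≤ c) :
    #(N ⊔ N' : Submodule R M) ≤ c := by
  rw [← Submodule.span_eq N, ← Submodule.span_eq N', ← Submodule.span_union]
  refine mk_span_le_of_surjective hc id Function.surjective_id hR _ ((mk_union_le _ _).trans ?_)
  exact add_le_of_le hc hN hN'

theorem mk_balancedTensor_le (hc : ℵ₀ ≤ c) (X : Type) [AddCommGroup X] [Module Rᵐᵒᵖ X]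
    (hX : lift.{u} #X ≤ c) (M : Type u) [AddCommGroup M] [Module R M] (hM : #M ≤ c) :
    #(BalancedTensor R X M) ≤ c := by
  let φ : ULift.{u} X × M → BalancedTensor R X M :=
    fun p => Submodule.Quotient.mk (p.1.down ⊗ₜ[ℤ] p.2)
  refine mk_le_of_span_eq_top (S := ℤ) hc ULift.down ULift.down_surjective
    (by simpa using hc) (Set.range φ) (mk_range_le.trans ?_) fun x => ?_
  · rw [mk_prod, lift_id, lift_id, mk_uLift]
    exact mul_le_of_le hc hX hM
  · induction x using Submodule.Quotient.induction_on with | _ t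
    induction t with
    | zero => exact Submodule.zero_mem _
    | tmul x m => exact Submodule.subset_span ⟨(⟨x⟩, m), rfl⟩
    | add s t hs ht => exact Submodule.add_mem _ hs ht

theorem mk_freeOn_le (hc : ℵ₀ ≤ c) (hR : #R ≤ c) (α : Type u) (hα : #α ≤ c) : #(α →₀ R) ≤ c := by
  refine mk_le_of_span_eq_top (S := R) hc id Function.surjective_id hR
    (Set.range fun a : α => Finsupp.single a (1 : R)) (mk_range_le.trans hα) fun x => ?_
  induction x using Finsupp.induction_linear with
  | zero => exact Submodule.zero_mem _
  | add f g hf hg => exact Submodule.add_mem _ hf hg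
  | single a r =>
    rw [← mul_one r, ← smul_eq_mul, ← Finsupp.smul_single]
    exact Submodule.smul_mem _ _ (Submodule.subset_span ⟨a, rfl⟩)

theorem mk_syzygies_le (hc : ℵ₀ ≤ c) (hR : #R ≤ c) (n : ℕ) (M : ModuleCat.{u} R) (hM : #M ≤ c) :
    #((syzygies n).obj M) ≤ c := by
  induction n with
  | zero => exact hM
  | succ n ih =>
    exact (mk_le_of_injective (syzygyι_injective ((syzygies n).obj M))).trans
      (mk_freeOn_le hc hR _ ih)

theorem mk_torRes_le (hc : ℵ₀ ≤ c) (hR : #R ≤ c) (X : ModuleCat.{0} Rᵐᵒᵖ)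
    (hX : lift.{u} #X ≤ c) (n : ℕ) (M : ModuleCat.{u} R) (hM : #M ≤ c) :
    #((torRes X n).obj M) ≤ c :=
  mk_balancedTensor_le hc X hX ((freeRes n).obj M)
    (mk_freeOn_le hc hR _ (mk_syzygies_le hc hR n M hM))

end Cardinality

/-! ### Counting finite systems -/

section SmallSets

variable {c : Cardinal.{u}}

theorem mk_sigma_nat_le (hc : ℵ₀ ≤ c) (f : ℕ → Type u) (hf : ∀ n, #(f n) ≤ c) :
    #(Σ n, f n) ≤ c := by
  rw [mk_sigma]
  refine (sum_le_sum _ (fun _ => c) hf).trans ?_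
  rw [sum_const, lift_uzero, mk_nat, lift_aleph0]
  exact mul_le_of_le hc hc le_rfl

theorem mk_fin_arrow_le (hc : ℵ₀ ≤ c) (n : ℕ) (α : Type u) (hα : #α ≤ c) :
    #(Fin n → α) ≤ c := by
  rw [mk_arrow, lift_uzero, mk_fin, lift_natCast, power_natCast]
  exact (pow_le_pow_left' hα n).trans (power_nat_le hc)

end SmallSets

/-! ### Closing small submodules under equations and boundaries -/

section Closure

variable {R : Type u} [Ring R] {c : Cardinal.{u}}

/-- Iterating an enlargement of submodules that preserves the bound `c` on cardinalities. -/
theorem exists_chain_of_enlargement {M : Type u} [AddCommGroup M] [Module R M]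
    {r : Submodule R M → Submodule R M → Prop}
    (hr : ∀ N : Submodule R M, #N ≤ c → ∃ N' : Submodule R M, #N' ≤ c ∧ N ≤ N' ∧ r N N')
    (N : Submodule R M) (hN : #N ≤ c) :
    ∃ f : ℕ → Submodule R M, f 0 = N ∧ Monotone f ∧ (∀ k, #(f k) ≤ c) ∧
      ∀ k, r (f k) (f (k + 1)) := by
  choose! e he hle hre using hr
  let f : ℕ → Submodule R M := fun k => e^[k] N
  have hs (k : ℕ) : f (k + 1) = e (f k) := Function.iterate_succ_apply' e k N
  have hf (k : ℕ) : #(f k) ≤ c := by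
    induction k with
    | zero => exact hN
    | succ k ih => rw [hs]; exact he _ ih
  refine ⟨f, rfl, monotone_nat_of_le_succ fun k => ?_, hf, fun k => ?_⟩
  · rw [hs]; exact hle _ (hf k)
  · rw [hs]; exact hre _ (hf k)

/-- Every finite system of linear equations with right-hand sides in `N` that is solvable in `M`
is solvable in `N'`. -/
def SolvesIn {M : Type u} [AddCommGroup M] [Module R M] (N N' : Submodule R M) : Prop :=
  ∀ (m n : ℕ) (a : Fin m → Fin n → R) (b : Fin m → N),
    (∃ x : Fin n → M, ∀ i, ∑ j, a i j • x j = b i) →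
      ∃ x : Fin n → M, (∀ j, x j ∈ N') ∧ ∀ i, ∑ j, a i j • x j = b i

theorem SolvesIn.mono {M : Type u} [AddCommGroup M] [Module R M] {N N' N'' : Submodule R M}
    (h : SolvesIn N N') (hle : N' ≤ N'') : SolvesIn N N'' := fun m n a b hb => by
  obtain ⟨x, hx, hx'⟩ := h m n a b hb
  exact ⟨x, fun j => hle (hx j), hx'⟩

/-- There are at most `c` finite systems over `R` with right-hand sides in `N`; one tuple is
adjoined for each. -/
theorem exists_solvesIn {M : Type u} [AddCommGroup M] [Module R M] (hc : ℵ₀ ≤ c) (hR : #R ≤ c)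
    (N : Submodule R M) (hN : #N ≤ c) : ∃ N' : Submodule R M, #N' ≤ c ∧ SolvesIn N N' := by
  let I := Σ (m n : ℕ), (Fin m → Fin n → R) × (Fin m → N)
  have hI : #I ≤ c := by
    refine mk_sigma_nat_le hc _ fun m => mk_sigma_nat_le hc _ fun n => ?_
    rw [mk_prod, lift_id, lift_id]
    exact mul_le_of_le hc (mk_fin_arrow_le hc _ _ (mk_fin_arrow_le hc _ _ hR))
      (mk_fin_arrow_le hc _ _ hN)
  let P (i : I) (x : Fin i.2.1 → M) : Prop := ∀ k, ∑ j, i.2.2.1 k j • x j = i.2.2.2 k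
  -- For an unsolvable system this is an arbitrary tuple, harmless for the cardinality bound.
  let sol (i : I) : Fin i.2.1 → M := Classical.epsilon (P i)
  refine ⟨Submodule.span R (⋃ i, Set.range (sol i)),
    mk_span_le_of_surjective hc id Function.surjective_id hR _ ((mk_iUnion_le _).trans ?_), ?_⟩
  · refine mul_le_of_le hc hI (ciSup_le' fun i => ?_)
    refine le_trans ?_ hc
    exact (Set.finite_range _).lt_aleph0.le
  · intro m n a b hb
    exact ⟨sol ⟨m, n, a, b⟩, fun j =>
      Submodule.subset_span (Set.mem_iUnion.2 ⟨⟨m, n, a, b⟩, j, rfl⟩),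
      Classical.epsilon_spec (p := P ⟨m, n, a, b⟩) hb⟩

/-- Lift the images of the generators of `F` to `x j` in `M`. The relations of `F` send `x` into
`L`, so some `y` in `L` takes the same values on them; `x - y` satisfies the relations and still
lifts `φ`. -/
theorem isPure_of_solvesIn {M : Type u} [AddCommGroup M] [Module R M] {L : Submodule R M}
    (h : SolvesIn L L) : IsPure L := by
  intro F _ _ _ φ
  obtain ⟨n, m, f, g, hf, hfg⟩ := Module.FinitePresentation.exists_fin' R F
  choose x hx using fun j : Fin n => L.mkQ_surjective (φ (f (Pi.single j 1)))
  have hlin {P : Type u} [AddCommGroup P] [Module R P] (ψ : (Fin n → R) →ₗ[R] P) (v : Fin n → R) :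
      ψ v = ∑ j, v j • ψ (Pi.single j 1) := by
    conv_lhs => rw [pi_eq_sum_univ' v, map_sum]
    refine Finset.sum_congr rfl fun j _ => ?_
    rw [← map_smul]
  have hgen (i : Fin m) : f (g (Pi.single i 1)) = 0 := hfg.apply_apply_eq_zero _
  have hb (i : Fin m) : ∑ j, g (Pi.single i 1) j • x j ∈ L := by
    rw [← Submodule.Quotient.mk_eq_zero, ← Submodule.mkQ_apply, map_sum]
    simp only [map_smul, hx]
    exact (hlin (φ ∘ₗ f) _).symm.trans ((congrArg φ (hgen i)).trans (map_zero φ))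
  obtain ⟨y, hyL, hy⟩ := h m n (fun i => g (Pi.single i 1)) (fun i => ⟨_, hb i⟩) ⟨x, fun i => rfl⟩
  let t : (Fin n → R) →ₗ[R] M := Fintype.linearCombination R (fun j => x j - y j)
  have ht : LinearMap.ker f ≤ LinearMap.ker t := by
    rw [hfg.linearMap_ker_eq, LinearMap.range_le_ker_iff]
    refine LinearMap.pi_ext' fun i => LinearMap.ext_ring ?_
    simp only [LinearMap.comp_apply, LinearMap.single_apply, LinearMap.zero_apply, t,
      Fintype.linearCombination_apply, smul_sub, Finset.sum_sub_distrib]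
    exact sub_eq_zero.2 (hy i).symm
  refine ⟨(LinearMap.ker f).liftQ t ht ∘ₗ (f.quotKerEquivOfSurjective hf).symm, ?_⟩
  rw [← LinearMap.cancel_right hf]
  refine LinearMap.pi_ext' fun j => LinearMap.ext_ring ?_
  have hsymm : (f.quotKerEquivOfSurjective hf).symm (f (Pi.single j 1)) =
      (LinearMap.ker f).mkQ (Pi.single j 1) :=
    (LinearEquiv.symm_apply_eq _).2 rfl
  simp only [LinearMap.comp_apply, LinearMap.single_apply, LinearEquiv.coe_coe, hsymm]
  rw [Submodule.mkQ_apply _ (Pi.single j 1), Submodule.liftQ_apply, ← hx j]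
  have : t (Pi.single j 1) = x j - y j := by simp [t, Fintype.linearCombination_apply_single]
  rw [this, map_sub, sub_eq_self]
  exact (Submodule.Quotient.mk_eq_zero L).2 (hyL j)

variable (X : ModuleCat.{0} Rᵐᵒᵖ)

/-- Every cycle of `N` in degree `n` becomes a boundary in `N'`. -/
def Resolves {M : ModuleCat.{u} R} (n : ℕ) (N N' : Submodule R M) : Prop :=
  ∃ h : N ≤ N', ∀ y : (torRes X n).obj (ModuleCat.of R N), IsTorCycle X n y →
    ∃ w, (torResD X n).app (ModuleCat.of R N') w =
      (torRes X n).map (ModuleCat.ofHom (Submodule.inclusion h)) y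

theorem Resolves.mono {M : ModuleCat.{u} R} {n : ℕ} {N N' N'' : Submodule R M}
    (h : Resolves X n N N') (hle : N' ≤ N'') : Resolves X n N N'' := by
  obtain ⟨h, H⟩ := h
  refine ⟨h.trans hle, fun y hy => ?_⟩
  obtain ⟨w, hw⟩ := H y hy
  refine ⟨(torRes X (n + 1)).map (ModuleCat.ofHom (Submodule.inclusion hle)) w, ?_⟩
  rw [torResD_naturality, hw, ← torRes_map_comp]
  rfl

/-- `M` is the directed union of its submodules of size at most `c`, so each cycle over `N` already
bounds in one of them; by `mk_torRes_le` only `c` of these are needed. -/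
theorem exists_resolves (hc : ℵ₀ ≤ c) (hR : #R ≤ c) (hX : lift.{u} #X ≤ c) {M : ModuleCat.{u} R}
    (n : ℕ) (hM : IsZero (tor n X M)) (N : Submodule R M) (hN : #N ≤ c) :
    ∃ N' : Submodule R M, #N' ≤ c ∧ Resolves X n N N' := by
  let S := {N : Submodule R M // #N ≤ c}
  have : IsDirectedOrder S := ⟨fun a b =>
    ⟨⟨a.1 ⊔ b.1, mk_sup_submodule_le hc hR _ _ a.2 b.2⟩,
      le_sup_left (a := a.1), le_sup_right (a := a.1)⟩⟩
  have : Nonempty S := ⟨⟨N, hN⟩⟩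
  let g : S →o Submodule R M := ⟨Subtype.val, fun _ _ h => h⟩
  have hg (x : M) : ∃ j, x ∈ g j :=
    ⟨⟨Submodule.span R {x}, mk_span_le_of_surjective hc id Function.surjective_id hR _
      (by simpa using one_le_aleph0.trans hc)⟩, Submodule.mem_span_singleton_self x⟩
  have key (y : {y : (torRes X n).obj (ModuleCat.of R N) // IsTorCycle X n y}) :
      ∃ (k : S) (h : N ≤ k.1), ∃ w, (torResD X n).app (ModuleCat.of R k.1) w =
        (torRes X n).map (ModuleCat.ofHom (Submodule.inclusion h)) y.1 := by
    obtain ⟨z, hz⟩ := (isZero_tor_iff X n M).1 hM _ (y.2.map X (ModuleCat.ofHom N.subtype))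
    obtain ⟨k, f, w, hw⟩ := exists_torBoundary X (isColimitSubmoduleCocone g hg) n
      (j := ⟨N, hN⟩) y.1 z hz
    exact ⟨k, leOfHom f, w, hw⟩
  choose k hk w hw using key
  refine ⟨N ⊔ ⨆ y, (k y).1, mk_sup_submodule_le hc hR _ _ hN (mk_iSup_submodule_le hc hR
    ((mk_subtype_le _).trans (mk_torRes_le hc hR X hX n _ hN)) _ fun y => (k y).2),
    le_sup_left, fun y hy => ?_⟩
  have hle : (k ⟨y, hy⟩).1 ≤ N ⊔ ⨆ y, (k y).1 := (le_iSup (fun y => (k y).1) _).trans le_sup_right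
  refine ⟨(torRes X (n + 1)).map (ModuleCat.ofHom (Submodule.inclusion hle)) (w ⟨y, hy⟩), ?_⟩
  rw [torResD_naturality, hw, ← torRes_map_comp]
  rfl

/-- A cycle over the union comes from a cycle over some `f k`, which bounds over `f (k + 1)`. -/
theorem isZero_tor_iSup_of_resolves {M : ModuleCat.{u} R} (n : ℕ) (f : ℕ → Submodule R M)
    (hf : Monotone f) (h : ∀ k, Resolves X n (f k) (f (k + 1))) :
    IsZero (tor n X (ModuleCat.of R (⨆ k, f k : Submodule R M))) := by
  rw [isZero_tor_iff]
  intro y hy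
  let g : ULift.{u} ℕ →o Submodule R M := ⟨fun k => f k.down, fun _ _ hkl => hf hkl⟩
  have hc := isColimitSubmoduleCoconeOfLE g (⨆ k, f k) (fun k => le_iSup f k.down) fun x hx => by
    obtain ⟨k, hk⟩ := (Submodule.mem_iSup_of_directed f hf.directed_le).1 hx
    exact ⟨⟨k⟩, hk⟩
  obtain ⟨⟨k⟩, z, hz, rfl⟩ := exists_isTorCycle_rep X hc n hy
  obtain ⟨_, H⟩ := h k
  obtain ⟨w, hw⟩ := H z hz
  refine ⟨(torRes X (n + 1)).map (ModuleCat.ofHom (Submodule.inclusion (le_iSup f (k + 1)))) w, ?_⟩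
  refine (torResD_naturality X n _ w).trans ((congrArg _ hw).trans ?_)
  exact (torRes_map_comp X n _ _ z).symm

theorem solvesIn_iSup {M : Type u} [AddCommGroup M] [Module R M] (f : ℕ → Submodule R M)
    (hf : Monotone f) (h : ∀ k, SolvesIn (f k) (f (k + 1))) : SolvesIn (⨆ k, f k) (⨆ k, f k) := by
  intro m n a b hb
  choose k hk using fun i => (Submodule.mem_iSup_of_directed f hf.directed_le).1 (b i).2
  obtain ⟨l, hl⟩ := Finset.exists_le (Finset.univ.image k)
  obtain ⟨x, hx, hx'⟩ := h l m n a
    (fun i => ⟨b i, hf (hl _ (Finset.mem_image_of_mem _ (Finset.mem_univ i))) (hk i)⟩) hb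
  exact ⟨x, fun j => Submodule.mem_iSup_of_mem (l + 1) (hx j), hx'⟩

/-- Every submodule of cardinality at most `c` of a module with vanishing `Tor` lies in a pure
submodule of cardinality at most `c` with vanishing `Tor`. -/
theorem exists_isPure_isZero_tor (hc : ℵ₀ ≤ c) (hR : #R ≤ c) (hX : lift.{u} #X ≤ c)
    {M : ModuleCat.{u} R} (hM : ∀ n, IsZero (tor n X M)) (N : Submodule R M) (hN : #N ≤ c) :
    ∃ L : Submodule R M, N ≤ L ∧ #L ≤ c ∧ IsPure L ∧
      ∀ n, IsZero (tor n X (ModuleCat.of R L)) := by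
  have hnat : #(ULift.{u} ℕ) ≤ c := by simpa using hc
  -- One enlargement treats linear systems and all degrees `n` at once, so a single `ω`-chain serves
  -- purity and every `Tor_n`.
  obtain ⟨f, rfl, hf, hfc, h⟩ := exists_chain_of_enlargement (M := M) (c := c)
    (r := fun N N' => SolvesIn N N' ∧ ∀ n, Resolves X n N N') (fun N hN => by
      obtain ⟨P, hP, hNP⟩ := exists_solvesIn hc hR N hN
      choose Q hQ hNQ using fun n => exists_resolves X hc hR hX n (hM n) N hN
      have hQ' (n : ℕ) : Q n ≤ P ⊔ ⨆ n : ULift.{u} ℕ, Q n.down :=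
        (le_iSup (fun n : ULift.{u} ℕ => Q n.down) ⟨n⟩).trans le_sup_right
      exact ⟨P ⊔ ⨆ n : ULift.{u} ℕ, Q n.down,
        mk_sup_submodule_le hc hR _ _ hP (mk_iSup_submodule_le hc hR hnat _ fun n => hQ n.down),
        (hNQ 0).1.trans (hQ' 0), hNP.mono le_sup_left, fun n => (hNQ n).mono X (hQ' n)⟩) N hN
  have hsup : (⨆ k, f k) = ⨆ k : ULift.{u} ℕ, f k.down := (Equiv.ulift.iSup_comp (g := f)).symm
  refine ⟨⨆ k, f k, le_iSup f 0, ?_, isPure_of_solvesIn (solvesIn_iSup f hf fun k => (h k).1),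
    fun n => isZero_tor_iSup_of_resolves X n f hf fun k => (h k).2 n⟩
  rw [hsup]
  exact mk_iSup_submodule_le hc hR hnat _ fun k => hfc k.down

end Closure

/-! ### Accessibility of the category of h-unitary modules -/

section Accessible

/-- Such modules are quotients of the free module on one fixed set of cardinality `c`. -/
theorem exists_small_family_of_card_le (R : Type u) [Ring R] (c : Cardinal.{u}) :
    ∃ (I : Type u) (F : I → ModuleCat.{u} R), ∀ M : ModuleCat.{u} R, #M ≤ c →
      ∃ i, Nonempty (M ≅ F i) := by
  refine ⟨Submodule R (c.out →₀ R), fun K => ModuleCat.of R ((c.out →₀ R) ⧸ K), fun M hM => ?_⟩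
  obtain ⟨i⟩ : Nonempty (M ↪ c.out) := by
    rw [← Cardinal.le_def, mk_out]
    exact hM
  let π : (c.out →₀ R) →ₗ[R] M := Finsupp.linearCombination _ (Function.invFun i)
  have hπ : Function.Surjective π := fun m => ⟨Finsupp.single (i m) 1, by
    simp [π, Function.leftInverse_invFun i.injective m]⟩
  exact ⟨LinearMap.ker π, ⟨(π.quotKerEquivOfSurjective hπ).symm.toModuleIso⟩⟩

theorem mk_unital_le (A : Type u) {c : Cardinal.{u}} (hc : ℵ₀ ≤ c) (hA : #A ≤ c) :
    #(Unital A) ≤ c := by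
  refine (mk_le_of_injective (f := fun x : Unital A => (x.fst, x.snd)) fun x y h =>
    Unitization.ext congr(($h).1) congr(($h).2)).trans ?_
  rw [mk_prod, lift_uzero]
  exact mul_le_of_le hc (by simpa using hc) hA

variable (A : Type u) [NonUnitalRing A] {c : Cardinal.{u}}

theorem lift_mk_trivialRightModule_le (hc : ℵ₀ ≤ c) : lift.{u} #(trivialRightModule A) ≤ c := by
  have : #(trivialRightModule A) = #ℤ := rfl
  rw [this]
  simpa using hc

variable {A}

/-- The inclusion into all modules is full and preserves filtered colimits, so presentability is
inherited from the ambient category. -/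
theorem isCardinalPresentable_hUnitary_of_card_le (hc : ℵ₀ ≤ c) (hA : #A ≤ c)
    [Fact (Order.succ c).IsRegular] (M : HUnitaryModuleCat A) (hM : #M.obj ≤ c) :
    IsCardinalPresentable M (Order.succ c) where
  preservesColimitOfShape J _ _ := by
    have := isFiltered_of_isCardinalFiltered J (Order.succ c)
    have := isCardinalPresentable_of_card_lt M.obj (Order.lt_succ_of_le (mk_unital_le A hc hA))
      (Order.lt_succ_of_le hM)
    have := preservesColimitsOfShape_of_isCardinalPresentable M.obj (Order.succ c) J
    have e : (isHUnitary A).ι ⋙ coyoneda.obj (Opposite.op M.obj) ≅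
        coyoneda.obj (Opposite.op M) :=
      NatIso.ofComponents fun N => (isHUnitary A).fullyFaithfulι.homEquiv.symm.toIso
    exact preservesColimitsOfShape_of_natIso e

theorem exists_pure_hUnitary_submodule (hc : ℵ₀ ≤ c) (hA : #A ≤ c) (M : HUnitaryModuleCat A)
    (N : Submodule (Unital A) M.obj) (hN : #N ≤ c) :
    ∃ L : Submodule (Unital A) M.obj, N ≤ L ∧
      IsPure L ∧ isHUnitary A (ModuleCat.of (Unital A) L) ∧ #L ≤ c := by
  obtain ⟨L, hNL, hL, hp, ht⟩ := exists_isPure_isZero_tor (trivialRightModule A) hc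
    (mk_unital_le A hc hA) (lift_mk_trivialRightModule_le A hc) M.property N hN
  exact ⟨L, hNL, hp, ht, hL⟩

theorem isDirectedUnion_pure_hUnitary (hc : ℵ₀ ≤ c) (hA : #A ≤ c) (M : HUnitaryModuleCat A) :
    IsDirectedUnion (Order.succ c) {L : Submodule (Unital A) M.obj |
      IsPure L ∧ isHUnitary A (ModuleCat.of (Unital A) L) ∧ #L ≤ c} := by
  have hR := mk_unital_le A hc hA
  refine ⟨fun T hT hTc => ?_, fun x => ?_⟩
  · obtain ⟨L, hNL, hL⟩ := exists_pure_hUnitary_submodule hc hA M (⨆ K : T, K.1)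
      (mk_iSup_submodule_le hc hR (Order.lt_succ_iff.1 hTc) _ fun K => (hT K.2).2.2)
    exact ⟨L, hL, fun K hK => (le_iSup (fun K : T => K.1) ⟨K, hK⟩).trans hNL⟩
  · obtain ⟨L, hNL, hL⟩ := exists_pure_hUnitary_submodule hc hA M (Submodule.span _ {x})
      (mk_span_le_of_surjective hc id Function.surjective_id hR _
        (by simpa using one_le_aleph0.trans hc))
    exact ⟨L, hL, hNL (Submodule.mem_span_singleton_self x)⟩

variable (A c) in
/-- The h-unitary modules of cardinality at most `c`. -/
def hUnitaryCardLE : ObjectProperty (HUnitaryModuleCat A) := fun M => #M.obj ≤ c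

theorem essentiallySmall_hUnitaryCardLE :
    ObjectProperty.EssentiallySmall.{u} (hUnitaryCardLE A c) where
  exists_small_le' := by
    obtain ⟨I, F, hF⟩ := exists_small_family_of_card_le (Unital A) c
    refine ⟨ObjectProperty.ofObj fun i : {i : I // isHUnitary A (F i)} => ⟨F i.1, i.2⟩,
      inferInstance, fun M hM => ?_⟩
    obtain ⟨i, ⟨e⟩⟩ := hF M.obj hM
    have hi : isHUnitary A (F i) := fun n =>
      (((tensorFunctor (trivialRightModule A)).leftDerived n).mapIso e).isZero_iff.1 (M.property n)
    exact ⟨_, ObjectProperty.ofObj_apply _ ⟨i, hi⟩, ⟨(isHUnitary A).isoMk e⟩⟩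

/-- The directed union of small pure h-unitary submodules is a colimit of modules, and the full
inclusion reflects colimits. -/
theorem isCardinalFilteredGenerator_hUnitaryCardLE (hc : ℵ₀ ≤ c) (hA : #A ≤ c)
    [Fact (Order.succ c).IsRegular] :
    (hUnitaryCardLE A c).IsCardinalFilteredGenerator (Order.succ c) where
  le_isCardinalPresentable M hM := isCardinalPresentable_hUnitary_of_card_le hc hA M hM
  exists_colimitsOfShape M := by
    obtain ⟨hdir, hcov⟩ := isDirectedUnion_pure_hUnitary hc hA M
    let S := {L : Submodule (Unital A) M.obj |
      IsPure L ∧ isHUnitary A (ModuleCat.of (Unital A) L) ∧ #L ≤ c}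
    let g : S →o Submodule (Unital A) M.obj := ⟨Subtype.val, fun _ _ h => h⟩
    have hS : IsCardinalFiltered S (Order.succ c) :=
      isCardinalFiltered_preorder _ _ fun K s hK => by
        obtain ⟨L, hL, hle⟩ := hdir (Set.range fun k => (s k).1)
          (by rintro _ ⟨k, rfl⟩; exact (s k).2) (mk_range_le.trans_lt hK)
        exact ⟨⟨L, hL⟩, fun k => hle _ ⟨k, rfl⟩⟩
    have := isFiltered_of_isCardinalFiltered S (Order.succ c)
    have hg := isColimitSubmoduleCocone g fun x => by
      obtain ⟨L, hL, hx⟩ := hcov x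
      exact ⟨⟨L, hL⟩, hx⟩
    let D : S ⥤ HUnitaryModuleCat A :=
      (isHUnitary A).lift (submoduleDiagram g) fun L => L.2.2.1
    let ι : D ⟶ (Functor.const S).obj M :=
      { app := fun L => ObjectProperty.homMk ((submoduleCocone g).ι.app L)
        naturality := fun L L' f => rfl }
    exact ⟨S, inferInstance, hS, ⟨{
      diag := D
      ι := ι
      isColimit := isColimitOfReflects (isHUnitary A).ι hg
      prop_diag_obj := fun L => L.2.2.2 }⟩⟩

variable (A) in
theorem isAccessibleCategory_hUnitaryModuleCat :
    IsAccessibleCategory.{u} (HUnitaryModuleCat A) := by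
  let c := max #A ℵ₀
  have hc : ℵ₀ ≤ c := le_max_right _ _
  have hA : #A ≤ c := le_max_left _ _
  have : Fact (Order.succ c).IsRegular := ⟨isRegular_succ hc⟩
  have := essentiallySmall_hUnitaryCardLE (A := A) (c := c)
  have := (isCardinalFilteredGenerator_hUnitaryCardLE hc hA).hasCardinalFilteredGenerator
  have : HasCardinalFilteredColimits (HUnitaryModuleCat A) (Order.succ c) := ⟨fun J _ _ => by
    have := isFiltered_of_isCardinalFiltered J (Order.succ c)
    infer_instance⟩
  exact ⟨Order.succ c, inferInstance, { }⟩

end Accessible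

end HUnitary

end

theorem mainTheorem8 (A : Type u) [NonUnitalRing A] :
    HasFiniteBiproducts (HUnitary.HUnitaryModuleCat A) ∧
    IsAccessibleCategory.{u} (HUnitary.HUnitaryModuleCat A) ∧
    ∀ (c : Cardinal.{u}) (hc : ℵ₀ ≤ c), #A ≤ c →
      haveI : Fact (Order.succ c).IsRegular := ⟨Cardinal.isRegular_succ hc⟩
      ∀ M : HUnitary.HUnitaryModuleCat A,
        HUnitary.IsDirectedUnion (Order.succ c)
          {L : Submodule (HUnitary.Unital A) M.obj |
            HUnitary.IsPure L ∧
            HUnitary.isHUnitary A (ModuleCat.of (HUnitary.Unital A) L) ∧ #L ≤ c} ∧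
        ∀ (L : Submodule (HUnitary.Unital A) M.obj)
          (hL : HUnitary.isHUnitary A (ModuleCat.of (HUnitary.Unital A) L)), #L ≤ c →
          IsCardinalPresentable
            (⟨ModuleCat.of (HUnitary.Unital A) L, hL⟩ : HUnitary.HUnitaryModuleCat A)
            (Order.succ c) := by
  refine ⟨HUnitary.hasFiniteBiproducts_hUnitaryModuleCat A,
    HUnitary.isAccessibleCategory_hUnitaryModuleCat A, fun c hc hA => ?_⟩
  have : Fact (Order.succ c).IsRegular := ⟨Cardinal.isRegular_succ hc⟩
  exact fun M => ⟨HUnitary.isDirectedUnion_pure_hUnitary hc hA M, fun L hL hLc =>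
    HUnitary.isCardinalPresentable_hUnitary_of_card_le hc hA ⟨_, hL⟩ hLc⟩
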